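/- Let $\Lambda$ be a $\lambda$-ring, that is, a commutative ring with maps $\lambda^n:\Lambda\to\Lambda$ ($n\ge 0$) such that $\lambda^0(x)=1$, $\lambda^1(x)=x$, $\lambda^n(1)=0$ for $n\ge 2$, $\lambda^n(x+y)=\sum_{i+j=n}\lambda^i(x)\lambda^j(y)$, $\lambda^n(xy)=P_n(\lambda^1(x),\dots,\lambda^n(x);\lambda^1(y),\dots,\lambda^n(y))$ and $\lambda^m(\lambda^n(x))=P_{m,n}(\lambda^1(x),\dots,\lambda^{mn}(x))$. Here $P_n$ and $P_{m,n}$ are the unique integer polynomials such that, with $e_i$ the elementary symmetric polynomials, $P_n(e_1(x),\dots,e_n(x);e_1(y),\dots,e_n(y))$ is the coefficient of $t^n$ in $\prod_{i,j=1}^n(1+x_iy_jt)$, and $P_{m,n}(e_1(x),\dots,e_{mn}(x))$ is the coefficient of $t^m$ in $\prod_{1\le i_1<\dots<i_n\le mn}(1+x_{i_1}\cdots x_{i_n}t)$. (This is often called a special $\lambda$-ring.) The Adams operations $\psi^n$, $n\ge 1$, are defined by $$\psi^n(x)=\sum_{i=1}^{n-1}(-1)^{i+1}\lambda^i(x)\,\psi^{n-i}(x)+(-1)^{n+1}n\lambda^n(x).$$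 Let $H_0\subset\Lambda$ be a binomial $\lambda$-subring, i.e. a subring whose additive group is torsion-free, in which every $h(h-1)\cdots(h-n+1)$ is divisible by $n!$, and on which $\lambda^n(h)=\binom{h}{n}$. Let $\varepsilon:\Lambda\to H_0$ be a ring homomorphism that commutes with all $\lambda^n$ and is the identity on $H_0$. Assume that the associated $\gamma$-filtration is finite: there exists $N\in\mathbb{N}$ such that $$\prod_i\lambda^{n_i}(x_i+n_i-1)=0$$ for all finite families of pairs $(x_i,n_i)$ with $x_i\in\ker\varepsilon$, $n_i\in\mathbb{N}$ and $\sum_i n_i\ge N$. Then for every integer $\ell>0$ the Adams operation $\psi^\ell$ restricts to a homomorphism of abelian groups $\ker\varepsilon\to\ker\varepsilon$, and there is an isomorphism of abelian groups $$\varinjlim\left(\ker\varepsilon\xrightarrow{\psi^\ell}\ker\varepsilon\xrightarrow{\psi^\ell}\ker\varepsilon\to\cdots\right)\;\cong\;(\ker\varepsilon)[1/\ell]$$ under $\ker\varepsilon$, i.e. compatible with the canonical map from the first term $\ker\varepsilon$ to the colimit and the localisation map $\ker\varepsilon\to(\ker\varepsilon)[1/\ell]$. -/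

import Mathlib

noncomputable section

section UniversalPolynomials

open MvPolynomial

/-! ### The universal polynomials of the theory of `λ`-rings -/

namespace LambdaRing

/-- The `k`-th elementary symmetric polynomial of the `n²` products `xᵢ yⱼ`, i.e. for `k = n`
the coefficient of `tⁿ` in `∏ᵢ ∏ⱼ (1 + xᵢ yⱼ t)`.
Here `xᵢ = X (inl i)` and `yⱼ = X (inr j)`. -/
def esymmOfProducts (n k : ℕ) : MvPolynomial (Fin n ⊕ Fin n) ℤ :=
  aeval (fun p : Fin n × Fin n =>
    (X (Sum.inl p.1) * X (Sum.inr p.2) : MvPolynomial (Fin n ⊕ Fin n) ℤ))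
    (esymm (Fin n × Fin n) ℤ k)

/-- Evaluation of a polynomial in `s₁, …, sₙ, σ₁, …, σₙ` at `sᵢ = eᵢ(x₁, …, xₙ)` and
`σᵢ = eᵢ(y₁, …, yₙ)`. -/
def evalEsymmPair (n : ℕ) :
    MvPolynomial (Fin n ⊕ Fin n) ℤ →ₐ[ℤ] MvPolynomial (Fin n ⊕ Fin n) ℤ :=
  aeval (Sum.elim
    (fun i : Fin n => rename Sum.inl (esymm (Fin n) ℤ ((i : ℕ) + 1)))
    (fun i : Fin n => rename Sum.inr (esymm (Fin n) ℤ ((i : ℕ) + 1))))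

/-- Evaluation of a polynomial in `s₁, …, s_k` at `sᵢ = eᵢ(x₁, …, x_k)`. -/
def evalEsymm (k : ℕ) : MvPolynomial (Fin k) ℤ →ₐ[ℤ] MvPolynomial (Fin k) ℤ :=
  aeval (fun i : Fin k => esymm (Fin k) ℤ ((i : ℕ) + 1))

/-- The `m`-th elementary symmetric polynomial of all products `x_{i₁} ⋯ x_{iₙ}`
with `i₁ < ⋯ < iₙ` in a set of `k` variables, i.e. the coefficient of `tᵐ` in
`∏_{i₁ < ⋯ < iₙ} (1 + x_{i₁} ⋯ x_{iₙ} t)`. -/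
def esymmOfSubsetProducts (k m n : ℕ) : MvPolynomial (Fin k) ℤ :=
  aeval (fun S : {S : Finset (Fin k) // S.card = n} =>
    (∏ i ∈ S.1, X i : MvPolynomial (Fin k) ℤ))
    (esymm {S : Finset (Fin k) // S.card = n} ℤ m)

theorem evalEsymm_injective (k : ℕ) : Function.Injective (evalEsymm k) := by
  intro p q h
  apply esymmAlgHom_fin_injective ℤ (le_refl k)
  apply Subtype.ext
  rw [esymmAlgHom_apply, esymmAlgHom_apply]
  exact h

theorem exists_evalEsymm_eq (k : ℕ) (p : MvPolynomial (Fin k) ℤ) (hp : p.IsSymmetric) :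
    ∃ P, evalEsymm k P = p := by
  obtain ⟨P, hP⟩ := (esymmAlgHom_fin_bijective ℤ k).2 ⟨p, hp⟩
  refine ⟨P, ?_⟩
  have := congrArg Subtype.val hP
  rw [esymmAlgHom_apply] at this
  exact this

theorem esymmOfSubsetProducts_isSymmetric (k m n : ℕ) :
    (esymmOfSubsetProducts k m n).IsSymmetric := by
  intro e
  let f : {S : Finset (Fin k) // S.card = n} ≃ {S : Finset (Fin k) // S.card = n} :=
    (e.finsetCongr).subtypeEquiv (fun S => by simp [Equiv.finsetCongr])
  rw [esymmOfSubsetProducts]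
  conv_rhs => rw [← rename_esymm _ ℤ m f, aeval_rename]
  rw [← AlgHom.comp_apply, comp_aeval]
  congr 2
  funext S
  simp [f, Equiv.finsetCongr]

theorem existsUnique_compPoly (m n : ℕ) :
    ∃! P : MvPolynomial (Fin (m * n)) ℤ,
      evalEsymm (m * n) P = esymmOfSubsetProducts (m * n) m n := by
  obtain ⟨P, hP⟩ := exists_evalEsymm_eq _ _ (esymmOfSubsetProducts_isSymmetric (m * n) m n)
  exact ⟨P, hP, fun Q hQ => evalEsymm_injective _ (hQ.trans hP.symm)⟩

/-- The same substitution as `evalEsymmPair`, in two steps. -/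
theorem sumAlgEquiv_evalEsymmPair (n : ℕ) (P : MvPolynomial (Fin n ⊕ Fin n) ℤ) :
    sumAlgEquiv ℤ (Fin n) (Fin n) (evalEsymmPair n P) =
      (esymmAlgHom (Fin n) (MvPolynomial (Fin n) ℤ) n
        (map (evalEsymm n : MvPolynomial (Fin n) ℤ →+* MvPolynomial (Fin n) ℤ)
          (sumAlgEquiv ℤ (Fin n) (Fin n) P))).val := by
  rw [esymmAlgHom_apply]
  induction P using MvPolynomial.induction_on with
  | C a => simp [evalEsymmPair]
  | add p q hp hq => simp only [map_add, hp, hq]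
  | mul_X p i hp =>
    rw [map_mul, map_mul, hp, map_mul, map_mul, map_mul]
    congr 1
    rcases i with i | i
    · have h := DFunLike.congr_fun (sumAlgEquiv_comp_rename_inl ℤ (Fin n) (Fin n))
        (esymm (Fin n) ℤ ((i : ℕ) + 1))
      simp only [evalEsymmPair, aeval_X, Sum.elim_inl, sumAlgEquiv_X_inl, map_X]
      refine h.trans ?_
      exact map_esymm _ _ _ _
    · have h := DFunLike.congr_fun (sumAlgEquiv_comp_rename_inr ℤ (Fin n) (Fin n))
        (esymm (Fin n) ℤ ((i : ℕ) + 1))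
      simp only [evalEsymmPair, aeval_X, Sum.elim_inr, sumAlgEquiv_X_inr, map_C]
      refine h.trans ?_
      simp [evalEsymm, algebraMap_eq]

theorem evalEsymmPair_injective (n : ℕ) : Function.Injective (evalEsymmPair n) := by
  intro P Q h
  have h' := congrArg (sumAlgEquiv ℤ (Fin n) (Fin n)) h
  rw [sumAlgEquiv_evalEsymmPair, sumAlgEquiv_evalEsymmPair] at h'
  have h2 := esymmAlgHom_fin_injective _ (le_refl n) (Subtype.ext h')
  exact (sumAlgEquiv ℤ (Fin n) (Fin n)).injective
    (map_injective _ (evalEsymm_injective n) h2)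

theorem existsUnique_prodPoly (n : ℕ) :
    ∃! P : MvPolynomial (Fin n ⊕ Fin n) ℤ, evalEsymmPair n P = esymmOfProducts n n := by
  suffices h : ∃ P, evalEsymmPair n P = esymmOfProducts n n by
    obtain ⟨P, hP⟩ := h
    exact ⟨P, hP, fun Q hQ => evalEsymmPair_injective _ (hQ.trans hP.symm)⟩
  set Q := sumAlgEquiv ℤ (Fin n) (Fin n) (esymmOfProducts n n) with hQ
  have hQ' : Q = aeval (fun p : Fin n × Fin n =>
      (X p.1 * C (X p.2) : MvPolynomial (Fin n) (MvPolynomial (Fin n) ℤ)))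
      (esymm (Fin n × Fin n) ℤ n) := by
    rw [hQ, esymmOfProducts]
    change (sumAlgEquiv ℤ (Fin n) (Fin n)).toAlgHom _ = _
    rw [← AlgHom.comp_apply, comp_aeval]
    congr 2
    funext p
    simp
  have hsymm : Q.IsSymmetric := by
    intro e
    rw [hQ']
    conv_rhs => rw [← rename_esymm _ ℤ n (e.prodCongr (Equiv.refl (Fin n))), aeval_rename]
    change ((rename e).restrictScalars ℤ) _ = _
    rw [← AlgHom.comp_apply, comp_aeval]
    congr 2
    funext p
    simp
  have hmap : ∀ e : Equiv.Perm (Fin n),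
      map (rename e : MvPolynomial (Fin n) ℤ →ₐ[ℤ] _).toRingHom Q = Q := by
    intro e
    rw [hQ']
    conv_rhs => rw [← rename_esymm _ ℤ n ((Equiv.refl (Fin n)).prodCongr e), aeval_rename]
    change (mapAlgHom (rename e : MvPolynomial (Fin n) ℤ →ₐ[ℤ] _)) _ = _
    rw [← AlgHom.comp_apply, comp_aeval]
    congr 2
    funext p
    simp
  obtain ⟨P₁, hP₁⟩ := (esymmAlgHom_fin_bijective (MvPolynomial (Fin n) ℤ) n).2 ⟨Q, hsymm⟩
  have hP₁' := congrArg Subtype.val hP₁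
  simp only [esymmAlgHom_apply] at hP₁'
  have hinv : ∀ e : Equiv.Perm (Fin n),
      map (rename e : MvPolynomial (Fin n) ℤ →ₐ[ℤ] _).toRingHom P₁ = P₁ := by
    intro e
    apply esymmAlgHom_fin_injective (MvPolynomial (Fin n) ℤ) (le_refl n)
    apply Subtype.ext
    rw [esymmAlgHom_apply, esymmAlgHom_apply, hP₁']
    conv_rhs => rw [← hmap e, ← hP₁']
    rw [map_aeval, aeval_def, eval₂_map, coe_eval₂Hom, algebraMap_eq]
    congr 1
    · ext <;> simp
    · funext i
      exact (map_esymm _ _ _ _).symm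
  have hrange : P₁ ∈ Set.range
      (map (evalEsymm n : MvPolynomial (Fin n) ℤ →+* MvPolynomial (Fin n) ℤ)
        (σ := Fin n)) := by
    rw [mem_range_map_iff_coeffs_subset]
    intro c hc
    obtain ⟨d, -, rfl⟩ := mem_coeffs_iff.1 hc
    obtain ⟨R, hR⟩ := exists_evalEsymm_eq n (coeff d P₁) (fun e => by
      conv_rhs => rw [← hinv e, coeff_map]
      rfl)
    exact ⟨R, hR⟩
  obtain ⟨P₂, hP₂⟩ := hrange
  refine ⟨(sumAlgEquiv ℤ (Fin n) (Fin n)).symm P₂, ?_⟩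
  apply (sumAlgEquiv ℤ (Fin n) (Fin n)).injective
  rw [sumAlgEquiv_evalEsymmPair, AlgEquiv.apply_symm_apply, hP₂, hP₁]

/-- The universal polynomial `Pₙ(s₁, …, sₙ; σ₁, …, σₙ)` for `λⁿ` of a product: the unique integer
polynomial such that `Pₙ(e₁(x), …, eₙ(x); e₁(y), …, eₙ(y))` is the coefficient of `tⁿ` in
`∏ᵢ ∏ⱼ (1 + xᵢ yⱼ t)`. -/
def prodPoly (n : ℕ) : MvPolynomial (Fin n ⊕ Fin n) ℤ := (existsUnique_prodPoly n).choose

theorem evalEsymmPair_prodPoly (n : ℕ) :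
    evalEsymmPair n (prodPoly n) = esymmOfProducts n n :=
  (existsUnique_prodPoly n).choose_spec.1

/-- The universal polynomial `P_{m,n}(s₁, …, s_{mn})` for `λᵐ ∘ λⁿ`: the unique integer polynomial
such that `P_{m,n}(e₁(x), …, e_{mn}(x))` is the coefficient of `tᵐ` in
`∏_{i₁ < ⋯ < iₙ ≤ mn} (1 + x_{i₁} ⋯ x_{iₙ} t)`. -/
def compPoly (m n : ℕ) : MvPolynomial (Fin (m * n)) ℤ := (existsUnique_compPoly m n).choose

theorem evalEsymm_compPoly (m n : ℕ) :
    evalEsymm (m * n) (compPoly m n) = esymmOfSubsetProducts (m * n) m n :=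
  (existsUnique_compPoly m n).choose_spec.1

end LambdaRing

end UniversalPolynomials

/-! ### `λ`-rings -/

/-- A (special) `λ`-ring structure on a commutative ring. -/
class LambdaRing (R : Type*) [CommRing R] where
  /-- The operation `λⁿ`. -/
  lam : ℕ → R → R
  lam_zero : ∀ x, lam 0 x = 1
  lam_one : ∀ x, lam 1 x = x
  lam_apply_one : ∀ n, 2 ≤ n → lam n 1 = 0
  lam_add : ∀ n x y, lam n (x + y) = ∑ i ∈ Finset.range (n + 1), lam i x * lam (n - i) y
  lam_mul : ∀ n x y, lam n (x * y) =
    MvPolynomial.aeval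
      (Sum.elim (fun i : Fin n => lam ((i : ℕ) + 1) x) (fun i : Fin n => lam ((i : ℕ) + 1) y))
      (LambdaRing.prodPoly n)
  lam_lam : ∀ m n x, lam m (lam n x) =
    MvPolynomial.aeval (fun i : Fin (m * n) => lam ((i : ℕ) + 1) x) (LambdaRing.compPoly m n)

namespace LambdaRing

variable {R : Type*} [CommRing R] [LambdaRing R]

/-- The Adams operation `ψⁿ`, `n ≥ 1`, defined by Newton's recursion
`ψⁿ = λ¹ ψⁿ⁻¹ - λ² ψⁿ⁻² + ⋯ + (-1)ⁿ λⁿ⁻¹ ψ¹ + (-1)ⁿ⁺¹ n λⁿ`.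
(The value at `n = 0` carries no meaning.) -/
def adams (n : ℕ) (x : R) : R :=
  (∑ i : Fin (n - 1), (-1) ^ (i : ℕ) * lam ((i : ℕ) + 1) x * adams (n - ((i : ℕ) + 1)) x)
    + (-1) ^ (n + 1) * (n : R) * lam n x
termination_by n
decreasing_by omega

/-- The operation `γⁿ(x) = λⁿ(x + n - 1)`. -/
def gamma (n : ℕ) (x : R) : R := lam n (x + (n : R) - 1)

/-- `H` is a binomial `λ`-subring: it is a binomial ring, and `λⁿ` restricts to the binomial
operation `h ↦ h (h - 1) ⋯ (h - n + 1) / n!` on it (so `H` is closed under all `λⁿ`). -/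
def IsBinomialLambdaSubring (H : Subring R) : Prop :=
  ∃ _ : BinomialRing H, ∀ (n : ℕ) (h : H), lam n (h : R) = (Ring.choose h n : H)

/-- `ε` is a retraction of `λ`-rings onto the subring `H`: a ring homomorphism that is the identity
on `H` and commutes with all `λⁿ`. -/
structure IsLambdaSection (H : Subring R) (ε : R →+* H) : Prop where
  apply_coe : ∀ h : H, ε (h : R) = h
  map_lam : ∀ (n : ℕ) (x : R), (ε (lam n x) : R) = lam n (ε x : R)

/-- The `γ`-filtration associated with `ε` is finite: for some `N`, all finite products
`γ^{n₁}(x₁) ⋯ γ^{n_k}(x_k)` with `xᵢ ∈ ker ε` and `n₁ + ⋯ + n_k ≥ N` vanish. -/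
def HasFiniteGammaFiltration {S : Type*} [CommRing S] (ε : R →+* S) : Prop :=
  ∃ N : ℕ, ∀ (k : ℕ) (x : Fin k → R) (n : Fin k → ℕ), (∀ i, x i ∈ RingHom.ker ε) →
    N ≤ ∑ i, n i → ∏ i, gamma (n i) (x i) = 0

end LambdaRing

/-! ### The colimit of an endomorphism -/

/-- The transition map from the `i`-th to the `j`-th term of the sequence `A → A → A → ⋯` all of
whose maps are `θ`; it is the iterate `θ^(j-i)`. -/
def EndColimit.step {A : Type*} [AddCommGroup A] (θ : AddMonoid.End A) (i j : ℕ) (_ : i ≤ j) :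
    A →+ A :=
  (θ ^ (j - i) : AddMonoid.End A)

/-- The colimit of `A → A → A → ⋯` with all maps equal to `θ`. -/
abbrev EndColimit {A : Type*} [AddCommGroup A] (θ : AddMonoid.End A) : Type _ :=
  AddCommGroup.DirectLimit (fun _ : ℕ => A) (EndColimit.step θ)

/-- The canonical map from the first term `A` to the colimit of `A → A → A → ⋯`. -/
def EndColimit.of {A : Type*} [AddCommGroup A] (θ : AddMonoid.End A) : A →+ EndColimit θ :=
  AddCommGroup.DirectLimit.of (fun _ : ℕ => A) (EndColimit.step θ) 0

/-- The localisation `A[1/ℓ]` of an abelian group. -/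
abbrev InvertInt (ℓ : ℤ) (A : Type*) [AddCommGroup A] : Type _ :=
  LocalizedModule (Submonoid.powers ℓ) A

/-- The canonical map `A → A[1/ℓ]`. -/
def InvertInt.of (ℓ : ℤ) (A : Type*) [AddCommGroup A] : A →+ InvertInt ℓ A :=
  (LocalizedModule.mkLinearMap (Submonoid.powers ℓ) A).toAddMonoidHom

end

open Finset

/-! Formally, `x + m` behaves like a sum of `m` line elements `1 + uᵢ` whose elementary symmetric
functions satisfy `eⱼ(u) = γʲ(x)`. Hence `ψᵐ(x) = ∑ᵢ ((1 + uᵢ)ᵐ - 1) = ∑_{r ≥ 1} (m choose r) pᵣ`,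
where `pᵣ` is the Newton power sum formed from the `γʲ(x)` (`adams_eq_sum_newtonSum_gamma`). Each
`pᵣ` has `γ`-weight `r`, so finiteness of the filtration kills it for `r ≥ N`. Since `(m choose r)`
is a rational polynomial in `m` of degree `r` without constant term, the coefficients of `ψ^(ℓʲ)(x)`
depend on `j` only through the powers `(ℓⁿ)ʲ` with `1 ≤ n < N`. As `(ψ^ℓ)ʲ = ψ^(ℓʲ)`, a product `∏
(θ - ℓⁱ)` with `i ≥ 1` annihilates `θ = ψ^ℓ` on `ker ε` (`exists_aeval_adamsKer_eq_zero`).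

Modulo `ℓ` this product is a power of `θ`, so `ℓ` divides a power of `θ`; its constant term is `±` a
power of `ℓ`, so `θ` divides a power of `ℓ`. Inverting `θ`, which is what the colimit does, is
therefore the same as inverting `ℓ` (`EndColimit.isLocalizedModule_of`).

That the `ψⁿ` are ring maps with `ψᵐ ψⁿ = ψᵐⁿ` follows from the description of `Pₙ` and `P_{m,n}` by
symmetric polynomials: the needed Newton identities are checked in polynomial rings, where power
sums are explicit, and then specialised to `λ`-operations. -/

namespace LambdaRing

/-! ### Newton's identities for arbitrary sequences. -/

section Newton

variable {R S : Type*} [CommRing R] [CommRing S]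

/-- The power sums attached to a sequence `a` of "elementary symmetric functions" by Newton's
recursion. -/
def newtonSum (a : ℕ → R) (n : ℕ) : R :=
  (∑ i : Fin (n - 1), (-1) ^ (i : ℕ) * a ((i : ℕ) + 1) * newtonSum a (n - ((i : ℕ) + 1)))
    + (-1) ^ (n + 1) * (n : R) * a n
termination_by n
decreasing_by omega

/-- Newton's identity in degree `n + 1` between the "elementary symmetric functions" `a` and the
"power sums" `q`. -/
def NewtonAt (a q : ℕ → R) (n : ℕ) : Prop :=
  ((n + 1 : ℕ) : R) * a (n + 1) = ∑ p ∈ antidiagonal n, a p.1 * ((-1) ^ p.2 * q (p.2 + 1))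

theorem newtonSum_zero (a : ℕ → R) : newtonSum a 0 = 0 := by
  rw [newtonSum]; simp

theorem newtonSum_succ (a : ℕ → R) (n : ℕ) : newtonSum a (n + 1) =
    (∑ i ∈ range n, (-1) ^ i * a (i + 1) * newtonSum a (n - i))
      + (-1) ^ n * ((n + 1 : ℕ) : R) * a (n + 1) := by
  rw [newtonSum, ← Fin.sum_univ_eq_sum_range
    (fun i => (-1) ^ i * a (i + 1) * newtonSum a (n - i)) n]
  have h : (-1 : R) ^ (n + 1 + 1) = (-1) ^ n := by ring
  rw [h]
  congr 1
  refine sum_congr rfl fun i _ => ?_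
  simp only [Nat.add_sub_add_right]

/-- The antidiagonal form suits generating functions, the form solved for `q (n + 1)` is the
recursion of `newtonSum`. They differ by the unit `(-1) ^ n` and by isolating the term with `a 0 =
1`. -/
theorem newtonAt_iff {a q : ℕ → R} (ha : a 0 = 1) (n : ℕ) :
    NewtonAt a q n ↔ q (n + 1) = (∑ i ∈ range n, (-1) ^ i * a (i + 1) * q (n - i))
      + (-1) ^ n * ((n + 1 : ℕ) : R) * a (n + 1) := by
  have h1 : (-1 : R) ^ n * (-1) ^ n = 1 := by rw [← mul_pow]; simp
  have key : ∑ p ∈ antidiagonal n, a p.1 * ((-1) ^ p.2 * q (p.2 + 1)) =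
      (-1) ^ n * (q (n + 1) - ∑ i ∈ range n, (-1) ^ i * a (i + 1) * q (n - i)) := by
    rw [Nat.sum_antidiagonal_eq_sum_range_succ (fun i j => a i * ((-1) ^ j * q (j + 1))),
      sum_range_succ', ha, mul_sub, mul_sum, sub_eq_neg_add, ← sum_neg_distrib]
    congr 1
    · refine sum_congr rfl fun i hi => ?_
      have hi' := mem_range.1 hi
      obtain ⟨d, rfl⟩ : ∃ d, n = i + 1 + d := ⟨n - (i + 1), by omega⟩
      have e1 : i + 1 + d - (i + 1) = d := by omega
      have e2 : i + 1 + d - i = d + 1 := by omega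
      have h2 : (-1 : R) ^ i * (-1) ^ i = 1 := by rw [← mul_pow]; simp
      rw [e1, e2, pow_add, pow_add]
      linear_combination (-(-1) ^ d * a (i + 1) * q (d + 1)) * h2
    · simp
  rw [NewtonAt, key]
  constructor
  · intro h
    linear_combination (-(q (n + 1) - ∑ i ∈ range n, (-1) ^ i * a (i + 1) * q (n - i))) * h1
      - (-1) ^ n * h
  · intro h
    linear_combination (-((n + 1 : ℕ) : R) * a (n + 1)) * h1 - (-1) ^ n * h

theorem newtonAt_newtonSum {a : ℕ → R} (ha : a 0 = 1) (n : ℕ) : NewtonAt a (newtonSum a) n :=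
  (newtonAt_iff ha n).2 (newtonSum_succ a n)

/-- Newton's identities determine the power sums. -/
theorem eq_newtonSum {a q : ℕ → R} (ha : a 0 = 1) (n : ℕ) (h : ∀ m ≤ n, NewtonAt a q m) :
    q (n + 1) = newtonSum a (n + 1) := by
  induction n using Nat.strong_induction_on with
  | _ n ih =>
    rw [(newtonAt_iff ha n).1 (h n le_rfl), newtonSum_succ]
    congr 1
    refine sum_congr rfl fun i hi => ?_
    have hi' := mem_range.1 hi
    obtain ⟨d, hd⟩ : ∃ d, n - i = d + 1 := ⟨n - i - 1, by omega⟩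
    rw [hd, ih d (by omega) fun m hm => h m (by omega)]

/-- In characteristic zero, Newton's identities determine the elementary symmetric functions. -/
theorem eq_of_newtonAt [CharZero R] [NoZeroDivisors R] {a b q : ℕ → R} (h0 : a 0 = b 0) (n : ℕ)
    (ha : ∀ m < n, NewtonAt a q m) (hb : ∀ m < n, NewtonAt b q m) : a n = b n := by
  induction n using Nat.strong_induction_on with
  | _ n ih =>
    cases n with
    | zero => exact h0
    | succ n =>
      refine mul_left_cancel₀ (Nat.cast_ne_zero.2 n.succ_ne_zero) ?_
      refine (ha n n.lt_succ_self).trans (Eq.trans ?_ (hb n n.lt_succ_self).symm)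
      refine sum_congr rfl fun p hp => ?_
      have hp' := mem_antidiagonal.1 hp
      rw [ih p.1 (by omega) (fun m hm => ha m (by omega)) fun m hm => hb m (by omega)]

theorem NewtonAt.map {a q : ℕ → R} {n : ℕ} (h : NewtonAt a q n) (f : R →+* S) :
    NewtonAt (fun i => f (a i)) (fun i => f (q i)) n := by
  have h' := congrArg f h
  simpa only [NewtonAt, map_mul, map_natCast, map_sum, map_pow, map_neg, map_one] using h'

theorem map_newtonSum (f : R →+* S) (a : ℕ → R) (n : ℕ) :
    f (newtonSum a n) = newtonSum (fun i => f (a i)) n := by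
  induction n using Nat.strong_induction_on with
  | _ n ih =>
    cases n with
    | zero => simp [newtonSum_zero]
    | succ n =>
      rw [newtonSum_succ, newtonSum_succ]
      simp only [map_mul, map_natCast, map_sum, map_pow, map_neg, map_one, map_add]
      congr 1
      exact sum_congr rfl fun i _ => by rw [ih (n - i) (by omega)]

theorem newtonSum_congr {a b : ℕ → R} (n : ℕ) (h : ∀ i, 1 ≤ i → i ≤ n → a i = b i) :
    newtonSum a n = newtonSum b n := by
  induction n using Nat.strong_induction_on with
  | _ n ih =>
    cases n with
    | zero => simp [newtonSum_zero]
    | succ n =>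
      rw [newtonSum_succ, newtonSum_succ, h (n + 1) (by omega) le_rfl]
      congr 1
      refine sum_congr rfl fun i hi => ?_
      have hi' := mem_range.1 hi
      rw [ih (n - i) (by omega) fun j h1 h2 => h j h1 (by omega), h (i + 1) (by omega) (by omega)]

theorem newtonSum_mem (V : Subring R) {a : ℕ → R} (n : ℕ)
    (h : ∀ i, 1 ≤ i → i ≤ n → a i ∈ V) : newtonSum a n ∈ V := by
  induction n using Nat.strong_induction_on with
  | _ n ih =>
    cases n with
    | zero => simp [newtonSum_zero]
    | succ n =>
      rw [newtonSum_succ]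
      refine V.add_mem (V.sum_mem fun i hi => ?_) ?_
      · have hi' := mem_range.1 hi
        exact V.mul_mem (V.mul_mem (V.pow_mem (V.neg_mem V.one_mem) _)
          (h _ (by omega) (by omega))) (ih _ (by omega) fun j h1 h2 => h j h1 (by omega))
      · exact V.mul_mem (V.mul_mem (V.pow_mem (V.neg_mem V.one_mem) _) (natCast_mem V _))
          (h _ (by omega) le_rfl)

/-- All Newton identities together say that the second series is the logarithmic derivative of the
first. Products of series then become sums of power sums by the Leibniz rule. -/
theorem newtonAt_iff_derivative {a q : ℕ → R} : (∀ n, NewtonAt a q n) ↔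
    PowerSeries.derivative R (PowerSeries.mk a) =
      PowerSeries.mk a * PowerSeries.mk (fun n => (-1) ^ n * q (n + 1)) := by
  rw [PowerSeries.ext_iff]
  refine forall_congr' fun n => ?_
  rw [PowerSeries.coeff_derivative, PowerSeries.coeff_mul, NewtonAt, mul_comm]
  simp only [PowerSeries.coeff_mk, Nat.cast_add, Nat.cast_one]

/-- Newton's identities for the Cauchy product of two sequences: the power sums add. -/
theorem NewtonAt.cauchy_mul {a b q r : ℕ → R} (ha : ∀ n, NewtonAt a q n)
    (hb : ∀ n, NewtonAt b r n) (n : ℕ) :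
    NewtonAt (fun n => ∑ p ∈ antidiagonal n, a p.1 * b p.2) (fun n => q n + r n) n := by
  refine newtonAt_iff_derivative.2 ?_ n
  have h1 : PowerSeries.mk (fun n => ∑ p ∈ antidiagonal n, a p.1 * b p.2) =
      PowerSeries.mk a * PowerSeries.mk b := by
    ext n
    simp [PowerSeries.coeff_mul]
  have h2 : PowerSeries.mk (fun n => (-1) ^ n * (q (n + 1) + r (n + 1))) =
      PowerSeries.mk (fun n => (-1) ^ n * q (n + 1)) +
        PowerSeries.mk (fun n => (-1) ^ n * r (n + 1)) := by
    ext n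
    simp [mul_add]
  rw [h1, h2, Derivation.leibniz, newtonAt_iff_derivative.1 ha,
    newtonAt_iff_derivative.1 hb, smul_eq_mul, smul_eq_mul]
  ring

theorem newtonAt_esymm_psum (σ : Type*) [Fintype σ] (n : ℕ) :
    NewtonAt (fun i => MvPolynomial.esymm σ R i) (fun i => MvPolynomial.psum σ R i) n := by
  classical
  have h := MvPolynomial.mul_esymm_eq_sum σ R (n + 1)
  rw [sum_filter, Nat.sum_antidiagonal_succ'] at h
  simp only [lt_irrefl, if_false, zero_add] at h
  rw [NewtonAt]
  refine h.trans ?_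
  rw [mul_sum]
  refine sum_congr rfl fun p hp => ?_
  have hp' := mem_antidiagonal.1 hp
  rw [if_pos (by omega), ← hp']
  have h2 : (-1 : MvPolynomial σ R) ^ p.1 * (-1) ^ p.1 = 1 := by rw [← mul_pow]; simp
  simp only [pow_add, pow_one]
  linear_combination ((-1) ^ p.2 * MvPolynomial.esymm σ R p.1 * MvPolynomial.psum σ R (p.2 + 1)) * h2

/-- Newton's identities for the elementary symmetric functions of a family of elements. -/
theorem newtonAt_aeval_esymm {σ : Type*} [Fintype σ] (y : σ → R) (n : ℕ) :
    NewtonAt (fun i => MvPolynomial.aeval y (MvPolynomial.esymm σ ℤ i)) (fun i => ∑ s, y s ^ i)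
      n := by
  simpa [MvPolynomial.psum] using
    (newtonAt_esymm_psum (R := ℤ) σ n).map (MvPolynomial.aeval y : _ →ₐ[ℤ] R).toRingHom

theorem newtonSum_aeval_esymm {σ : Type*} [Fintype σ] (y : σ → R) {n : ℕ} (hn : 0 < n) :
    newtonSum (fun i => MvPolynomial.aeval y (MvPolynomial.esymm σ ℤ i)) n = ∑ s, y s ^ n := by
  obtain ⟨n, rfl⟩ : ∃ m, n = m + 1 := ⟨n - 1, by omega⟩
  exact (eq_newtonSum (by simp) n fun m _ => newtonAt_aeval_esymm y m).symm

end Newton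

/-! ### Transfer of Newton's identities from specialisations. -/

/-- If two families satisfy Newton's identities after specialisation and the specialisations are
injective on the subrings where the families live, then Newton's identities hold universally. -/
theorem newtonAt_of_specializations {U : Type*} [CommRing U] {T : ℕ → Type*}
    [∀ k, CommRing (T k)] [∀ k, CharZero (T k)] [∀ k, NoZeroDivisors (T k)]
    (π : ∀ k, U →+* T k) (V : ℕ → Subring U) (hV : Monotone V)
    (hπ : ∀ k, ∀ D ∈ V k, π k D = 0 → D = 0)
    {κ : ℕ → ℕ} (hκ : Monotone κ) {a q : ℕ → U} (ha : ∀ n, a n ∈ V (κ n))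
    (hq : ∀ n, q n ∈ V (κ n)) {b : ∀ k, ℕ → T k}
    (hb : ∀ k n, NewtonAt (b k) (fun i => π k (q i)) n) (hb0 : ∀ k, b k 0 = 1) (ha0 : a 0 = 1)
    (hab : ∀ n, π (κ n) (a n) = b (κ n) n) (n : ℕ) : NewtonAt a q n := by
  induction n using Nat.strong_induction_on with
  | _ n ih =>
    -- `hab` compares `a i` and `b` only at level `κ i`. The Newton identities already proved in
    -- lower degrees carry the comparison to level `κ (n + 1)`, where the identity of degree `n` can
    -- be tested.
    have hst : ∀ i ≤ n, π (κ (n + 1)) (a i) = b (κ (n + 1)) i := fun i hi =>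
      eq_of_newtonAt (a := fun i => π (κ (n + 1)) (a i)) (by simp [ha0, hb0]) i
        (fun m hm => (ih m (by omega)).map _) fun m _ => hb _ m
    rw [NewtonAt, ← sub_eq_zero]
    refine hπ (κ (n + 1)) _ ?_ ?_
    · refine sub_mem (mul_mem (natCast_mem _ _) (ha _)) (sum_mem fun p hp => ?_)
      have hp' := mem_antidiagonal.1 hp
      exact mul_mem (hV (hκ (by omega)) (ha p.1)) (mul_mem (pow_mem (neg_mem (one_mem _)) _)
        (hV (hκ (by omega)) (hq _)))
    · have h := hb (κ (n + 1)) n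
      rw [NewtonAt, ← hab] at h
      rw [map_sub, map_mul, map_natCast, h, sub_eq_zero, map_sum]
      refine sum_congr rfl fun p hp => ?_
      have hp' := mem_antidiagonal.1 hp
      simp only [map_mul, map_pow, map_neg, map_one, hst p.1 (by omega)]

/-- Under universal Newton identities, specialisations are determined by their power sums. -/
theorem map_eq_of_newtonAt {U T : Type*} [CommRing U] [CommRing T] [CharZero T] [NoZeroDivisors T]
    (π : U →+* T) {a q : ℕ → U} {b : ℕ → T} (h : ∀ n, NewtonAt a q n)
    (hb : ∀ n, NewtonAt b (fun i => π (q i)) n) (ha0 : a 0 = 1) (hb0 : b 0 = 1) (n : ℕ) :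
    π (a n) = b n :=
  eq_of_newtonAt (a := fun i => π (a i)) (by simp [ha0, hb0]) n (fun m _ => (h m).map _)
    fun m _ => hb m

/-! ### Universal polynomials in infinitely many variables and their power sums. -/

section Universal

open MvPolynomial

/-- The sequence `1, X₀, X₁, …` of a family of variables. -/
noncomputable def varSeq {σ : Type*} (f : ℕ → σ) : ℕ → MvPolynomial σ ℤ
  | 0 => 1
  | i + 1 => X (f i)

/-- Specialisation of infinitely many variables to the elementary symmetric polynomials in `k`
variables. -/
noncomputable def toEsymm (k : ℕ) : MvPolynomial ℕ ℤ →ₐ[ℤ] MvPolynomial (Fin k) ℤ :=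
  aeval fun i => esymm (Fin k) ℤ (i + 1)

/-- Specialisation of two infinite families of variables to the elementary symmetric polynomials
in two families of `k` variables. -/
noncomputable def toEsymmPair (k : ℕ) : MvPolynomial (ℕ ⊕ ℕ) ℤ →ₐ[ℤ] MvPolynomial (Fin k ⊕ Fin k) ℤ :=
  aeval (Sum.elim (fun i => rename Sum.inl (esymm (Fin k) ℤ (i + 1)))
    (fun i => rename Sum.inr (esymm (Fin k) ℤ (i + 1))))

/-- The polynomials in the first `k` variables. -/
noncomputable def lowVars (k : ℕ) : Subring (MvPolynomial ℕ ℤ) :=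
  (rename (Fin.val : Fin k → ℕ) : _ →ₐ[ℤ] MvPolynomial ℕ ℤ).toRingHom.range

/-- The polynomials in the first `k` variables of each of two families. -/
noncomputable def lowVarsPair (k : ℕ) : Subring (MvPolynomial (ℕ ⊕ ℕ) ℤ) :=
  (rename (Sum.map Fin.val Fin.val : Fin k ⊕ Fin k → ℕ ⊕ ℕ) :
    _ →ₐ[ℤ] MvPolynomial (ℕ ⊕ ℕ) ℤ).toRingHom.range

theorem rename_mem_lowVars {k : ℕ} (P : MvPolynomial (Fin k) ℤ) :
    rename (Fin.val : Fin k → ℕ) P ∈ lowVars k := ⟨P, rfl⟩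

theorem rename_mem_lowVarsPair {k : ℕ} (P : MvPolynomial (Fin k ⊕ Fin k) ℤ) :
    rename (Sum.map Fin.val Fin.val : Fin k ⊕ Fin k → ℕ ⊕ ℕ) P ∈ lowVarsPair k := ⟨P, rfl⟩

theorem lowVars_mono : Monotone lowVars := by
  rintro k l hkl _ ⟨P, rfl⟩
  refine ⟨rename (Fin.castLE hkl) P, ?_⟩
  change rename _ (rename _ P) = rename _ P
  rw [rename_rename]
  rfl

theorem lowVarsPair_mono : Monotone lowVarsPair := by
  rintro k l hkl _ ⟨P, rfl⟩
  refine ⟨rename (Sum.map (Fin.castLE hkl) (Fin.castLE hkl)) P, ?_⟩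
  change rename _ (rename _ P) = rename _ P
  rw [rename_rename, Sum.map_comp_map]
  rfl

theorem varSeq_mem_lowVars {k i : ℕ} (hi : i ≤ k) : varSeq id i ∈ lowVars k := by
  cases i with
  | zero => exact one_mem _
  | succ i =>
    have := rename_mem_lowVars (X (⟨i, hi⟩ : Fin k) : MvPolynomial (Fin k) ℤ)
    rwa [rename_X] at this

theorem varSeq_inl_mem_lowVarsPair {k i : ℕ} (hi : i ≤ k) : varSeq Sum.inl i ∈ lowVarsPair k := by
  cases i with
  | zero => exact one_mem _
  | succ i =>
    have := rename_mem_lowVarsPair (X (Sum.inl ⟨i, hi⟩) : MvPolynomial (Fin k ⊕ Fin k) ℤ)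
    rwa [rename_X] at this

theorem varSeq_inr_mem_lowVarsPair {k i : ℕ} (hi : i ≤ k) : varSeq Sum.inr i ∈ lowVarsPair k := by
  cases i with
  | zero => exact one_mem _
  | succ i =>
    have := rename_mem_lowVarsPair (X (Sum.inr ⟨i, hi⟩) : MvPolynomial (Fin k ⊕ Fin k) ℤ)
    rwa [rename_X] at this

theorem toEsymm_rename {k : ℕ} (P : MvPolynomial (Fin k) ℤ) :
    toEsymm k (rename Fin.val P) = evalEsymm k P := by
  rw [toEsymm, aeval_rename, evalEsymm]
  rfl

theorem toEsymmPair_rename {k : ℕ} (P : MvPolynomial (Fin k ⊕ Fin k) ℤ) :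
    toEsymmPair k (rename (Sum.map Fin.val Fin.val) P) = evalEsymmPair k P := by
  rw [toEsymmPair, aeval_rename, evalEsymmPair, Sum.elim_comp_map]
  rfl

/-- Algebraic independence of `e₁, …, e_k`: an identity involving only the first `k` variables may
be checked on honest symmetric polynomials in `k` variables. -/
theorem eq_zero_of_toEsymm_eq_zero (k : ℕ) (D : MvPolynomial ℕ ℤ) (hD : D ∈ lowVars k)
    (h : toEsymm k D = 0) : D = 0 := by
  obtain ⟨P, rfl⟩ := hD
  have h' : evalEsymm k P = 0 := by rw [← toEsymm_rename]; exact h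
  rw [evalEsymm_injective k (h'.trans (map_zero _).symm), map_zero]

theorem eq_zero_of_toEsymmPair_eq_zero (k : ℕ) (D : MvPolynomial (ℕ ⊕ ℕ) ℤ)
    (hD : D ∈ lowVarsPair k) (h : toEsymmPair k D = 0) : D = 0 := by
  obtain ⟨P, rfl⟩ := hD
  have h' : evalEsymmPair k P = 0 := by rw [← toEsymmPair_rename]; exact h
  rw [evalEsymmPair_injective k (h'.trans (map_zero _).symm), map_zero]

theorem toEsymm_varSeq (k i : ℕ) : toEsymm k (varSeq id i) = esymm (Fin k) ℤ i := by
  cases i with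
  | zero => simp [varSeq]
  | succ i => simp [varSeq, toEsymm]

theorem toEsymmPair_varSeq_inl (k i : ℕ) :
    toEsymmPair k (varSeq Sum.inl i) =
      aeval (fun j => X (Sum.inl j) : Fin k → MvPolynomial (Fin k ⊕ Fin k) ℤ)
        (esymm (Fin k) ℤ i) := by
  cases i with
  | zero => simp [varSeq]
  | succ i =>
    rw [varSeq, toEsymmPair, aeval_X]
    simp only [Sum.elim_inl, rename_eq_aeval, Function.comp_def]

theorem toEsymmPair_varSeq_inr (k i : ℕ) :
    toEsymmPair k (varSeq Sum.inr i) =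
      aeval (fun j => X (Sum.inr j) : Fin k → MvPolynomial (Fin k ⊕ Fin k) ℤ)
        (esymm (Fin k) ℤ i) := by
  cases i with
  | zero => simp [varSeq]
  | succ i =>
    rw [varSeq, toEsymmPair, aeval_X]
    simp only [Sum.elim_inr, rename_eq_aeval, Function.comp_def]

theorem toEsymm_newtonSum (k : ℕ) {n : ℕ} (hn : 0 < n) :
    toEsymm k (newtonSum (varSeq id) n) = ∑ j, X j ^ n := by
  rw [← newtonSum_aeval_esymm _ hn]
  refine (map_newtonSum (toEsymm k).toRingHom _ n).trans (newtonSum_congr n fun i _ _ => ?_)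
  refine (toEsymm_varSeq k i).trans ?_
  exact (aeval_X_left_apply _).symm

theorem toEsymmPair_newtonSum_inl (k : ℕ) {n : ℕ} (hn : 0 < n) :
    toEsymmPair k (newtonSum (varSeq Sum.inl) n) = ∑ j, X (Sum.inl j) ^ n := by
  rw [← newtonSum_aeval_esymm _ hn]
  exact (map_newtonSum (toEsymmPair k).toRingHom _ n).trans
    (newtonSum_congr n fun i _ _ => toEsymmPair_varSeq_inl k i)

theorem toEsymmPair_newtonSum_inr (k : ℕ) {n : ℕ} (hn : 0 < n) :
    toEsymmPair k (newtonSum (varSeq Sum.inr) n) = ∑ j, X (Sum.inr j) ^ n := by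
  rw [← newtonSum_aeval_esymm _ hn]
  exact (map_newtonSum (toEsymmPair k).toRingHom _ n).trans
    (newtonSum_congr n fun i _ _ => toEsymmPair_varSeq_inr k i)

/-- The polynomials `Pₙ` in infinitely many variables. -/
noncomputable def univProd (n : ℕ) : MvPolynomial (ℕ ⊕ ℕ) ℤ := rename (Sum.map Fin.val Fin.val) (prodPoly n)

theorem univProd_zero : univProd 0 = 1 := by
  have h : prodPoly 0 = 1 := by
    apply evalEsymmPair_injective
    rw [evalEsymmPair_prodPoly, esymmOfProducts]
    simp
  rw [univProd, h, map_one]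

/-- The power sums of the universal product polynomials are products of power sums. -/
theorem newtonAt_univProd (n : ℕ) : NewtonAt univProd
    (fun i => newtonSum (varSeq Sum.inl) i * newtonSum (varSeq Sum.inr) i) n := by
  refine newtonAt_of_specializations (fun k => (toEsymmPair k).toRingHom) lowVarsPair
    lowVarsPair_mono eq_zero_of_toEsymmPair_eq_zero monotone_id (b := fun k i => esymmOfProducts k i)
    (fun n => rename_mem_lowVarsPair _) (fun n => ?_) (fun k n => ?_) (fun k => ?_) univProd_zero
    (fun n => ?_) n
  · exact mul_mem (newtonSum_mem _ n fun i _ hi => varSeq_inl_mem_lowVarsPair hi)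
      (newtonSum_mem _ n fun i _ hi => varSeq_inr_mem_lowVarsPair hi)
  · have h := newtonAt_aeval_esymm (fun p : Fin k × Fin k =>
      (X (Sum.inl p.1) * X (Sum.inr p.2) : MvPolynomial (Fin k ⊕ Fin k) ℤ)) n
    refine h.trans (sum_congr rfl fun p _ => ?_)
    congr 2
    change _ = toEsymmPair k _
    rw [map_mul, toEsymmPair_newtonSum_inl k p.2.succ_pos, toEsymmPair_newtonSum_inr k p.2.succ_pos,
      sum_mul_sum]
    simp only [mul_pow]
    exact Fintype.sum_prod_type _
  · simp [esymmOfProducts]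
  · exact (toEsymmPair_rename _).trans (evalEsymmPair_prodPoly n)

/-- The right-hand side is invariant under permutations. It has degree `m * n`, so `m * n` variables
are enough to pin down the universal expression. -/
theorem exists_evalEsymm_eq_esymm_pow (m n : ℕ) : ∃ P, evalEsymm (m * n) P =
    aeval (fun j => X j ^ m : Fin (m * n) → MvPolynomial (Fin (m * n)) ℤ)
      (esymm (Fin (m * n)) ℤ n) := by
  refine exists_evalEsymm_eq _ _ fun e => ?_
  conv_rhs => rw [← rename_esymm _ ℤ n e, aeval_rename]
  rw [← AlgHom.comp_apply, comp_aeval]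
  congr 2
  funext j
  simp

/-- The polynomial expressing `eₙ(x₁ᵐ, x₂ᵐ, …)` through elementary symmetric polynomials. -/
noncomputable def univPow (m n : ℕ) : MvPolynomial ℕ ℤ :=
  rename Fin.val (exists_evalEsymm_eq_esymm_pow m n).choose

theorem univPow_mem_lowVars (m n : ℕ) : univPow m n ∈ lowVars (m * n) := rename_mem_lowVars _

theorem toEsymm_univPow_self (m n : ℕ) : toEsymm (m * n) (univPow m n) =
    aeval (fun j => X j ^ m : Fin (m * n) → MvPolynomial (Fin (m * n)) ℤ)
      (esymm (Fin (m * n)) ℤ n) :=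
  (toEsymm_rename _).trans (exists_evalEsymm_eq_esymm_pow m n).choose_spec

theorem univPow_zero_right (m : ℕ) : univPow m 0 = 1 := by
  rw [← sub_eq_zero]
  refine eq_zero_of_toEsymm_eq_zero (m * 0) _ (sub_mem (univPow_mem_lowVars m 0) (one_mem _)) ?_
  rw [map_sub, toEsymm_univPow_self]
  simp

/-- The `i`-th power sum of the elements `xⱼᵐ` is the power sum of degree `m * i` of the `xⱼ`. -/
theorem newtonAt_esymm_pow {m : ℕ} (hm : 0 < m) (k n : ℕ) :
    NewtonAt (fun i => aeval (fun j => X j ^ m : Fin k → MvPolynomial (Fin k) ℤ)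
      (esymm (Fin k) ℤ i)) (fun i => toEsymm k (newtonSum (varSeq id) (m * i))) n := by
  have h := newtonAt_aeval_esymm (fun j => X j ^ m : Fin k → MvPolynomial (Fin k) ℤ) n
  refine h.trans (sum_congr rfl fun p _ => ?_)
  simp only [toEsymm_newtonSum k (Nat.mul_pos hm p.2.succ_pos), pow_mul]
  rfl

theorem newtonAt_univPow {m : ℕ} (hm : 0 < m) (n : ℕ) :
    NewtonAt (univPow m) (fun i => newtonSum (varSeq id) (m * i)) n := by
  refine newtonAt_of_specializations (fun k => (toEsymm k).toRingHom) lowVars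
    lowVars_mono eq_zero_of_toEsymm_eq_zero (κ := fun n => m * n)
    (fun _ _ h => Nat.mul_le_mul_left m h) (univPow_mem_lowVars m) (fun n => ?_)
    (newtonAt_esymm_pow hm) (fun k => ?_) (univPow_zero_right m) (toEsymm_univPow_self m) n
  · exact newtonSum_mem _ _ fun i _ hi => varSeq_mem_lowVars hi
  · simp

/-- `univPow m n` was chosen using exactly `m * n` variables. Since its power sums are now known
universally, the formula is independent of the number `k` of variables. -/
theorem toEsymm_univPow {m : ℕ} (hm : 0 < m) (k n : ℕ) : toEsymm k (univPow m n) =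
    aeval (fun j => X j ^ m : Fin k → MvPolynomial (Fin k) ℤ) (esymm (Fin k) ℤ n) :=
  map_eq_of_newtonAt (toEsymm k).toRingHom
    (b := fun n => aeval (fun j => X j ^ m : Fin k → MvPolynomial (Fin k) ℤ) (esymm (Fin k) ℤ n))
    (newtonAt_univPow hm) (newtonAt_esymm_pow hm k) (univPow_zero_right m) (by simp) n

/-- The polynomials `P_{m,n}` in infinitely many variables. -/
noncomputable def univComp (m n : ℕ) : MvPolynomial ℕ ℤ := rename Fin.val (compPoly m n)

theorem toEsymm_univComp_self (m n : ℕ) :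
    toEsymm (m * n) (univComp m n) = esymmOfSubsetProducts (m * n) m n :=
  (toEsymm_rename _).trans (evalEsymm_compPoly m n)

theorem univComp_zero_left (n : ℕ) : univComp 0 n = 1 := by
  rw [← sub_eq_zero]
  refine eq_zero_of_toEsymm_eq_zero (0 * n) _ (sub_mem (rename_mem_lowVars _) (one_mem _)) ?_
  rw [map_sub, toEsymm_univComp_self]
  simp [esymmOfSubsetProducts]

/-- The `m`-th power sum of the products `x_S` over `n`-element sets `S` is `∑_S ∏_{i ∈ S} xᵢᵐ`,
which is `eₙ(x₁ᵐ, x₂ᵐ, …)`. -/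
theorem newtonAt_univComp (n m : ℕ) :
    NewtonAt (fun m => univComp m n) (fun m => univPow m n) m := by
  refine newtonAt_of_specializations (fun k => (toEsymm k).toRingHom) lowVars
    lowVars_mono eq_zero_of_toEsymm_eq_zero (κ := fun m => m * n)
    (fun _ _ h => Nat.mul_le_mul_right n h) (fun m => rename_mem_lowVars _)
    (fun m => univPow_mem_lowVars m n) (b := fun k m => esymmOfSubsetProducts k m n)
    (fun k m => ?_) (fun k => ?_) (univComp_zero_left n) (fun m => toEsymm_univComp_self m n) m
  · have h := newtonAt_aeval_esymm (fun S : {S : Finset (Fin k) // S.card = n} =>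
      (∏ i ∈ S.1, X i : MvPolynomial (Fin k) ℤ)) m
    refine h.trans (sum_congr rfl fun p _ => ?_)
    congr 2
    change _ = toEsymm k _
    rw [toEsymm_univPow p.2.succ_pos, esymm, map_sum,
      sum_subtype (powersetCard n univ) (p := fun S : Finset (Fin k) => S.card = n) (by simp)]
    refine sum_congr rfl fun S _ => ?_
    simp [Finset.prod_pow]
  · simp [esymmOfSubsetProducts]

end Universal

/-! ### Adams operations: additivity, multiplicativity, composition. -/

section AdamsOperations

variable {R : Type*} [CommRing R] [LambdaRing R]

theorem adams_eq_newtonSum (n : ℕ) (x : R) : adams n x = newtonSum (fun i => lam i x) n := by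
  induction n using Nat.strong_induction_on with
  | _ n ih =>
    rw [adams, newtonSum]
    congr 1
    refine sum_congr rfl fun i _ => ?_
    rw [ih _ (by omega)]

theorem newtonAt_lam_adams (x : R) (n : ℕ) :
    NewtonAt (fun i => lam i x) (fun i => adams i x) n := by
  simpa only [adams_eq_newtonSum] using newtonAt_newtonSum (lam_zero x) n

theorem eq_adams {q : ℕ → R} {x : R} (h : ∀ n, NewtonAt (fun i => lam i x) q n) {n : ℕ}
    (hn : 0 < n) : q n = adams n x := by
  obtain ⟨n, rfl⟩ : ∃ m, n = m + 1 := ⟨n - 1, by omega⟩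
  rw [adams_eq_newtonSum]
  exact eq_newtonSum (lam_zero x) n fun m _ => h m

theorem adams_zero_left (x : R) : adams 0 x = 0 := by
  rw [adams_eq_newtonSum, newtonSum_zero]

theorem adams_one_left (x : R) : adams 1 x = x := by
  rw [adams_eq_newtonSum, newtonSum_succ]
  simp [lam_one]

theorem adams_add (n : ℕ) (x y : R) : adams n (x + y) = adams n x + adams n y := by
  rcases n.eq_zero_or_pos with rfl | hn
  · simp [adams_zero_left]
  refine (eq_adams (q := fun i => adams i x + adams i y) (fun m => ?_) hn).symm
  have h : (fun i => lam i (x + y)) =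
      fun n => ∑ p ∈ antidiagonal n, lam p.1 x * lam p.2 y := by
    funext n
    rw [lam_add, Nat.sum_antidiagonal_eq_sum_range_succ (fun i j => lam i x * lam j y)]
  rw [h]
  exact NewtonAt.cauchy_mul (newtonAt_lam_adams x) (newtonAt_lam_adams y) m

/-- The generating series of the `λⁿ(1)` is `1 + t`, that of a single root `1`, so all power sums
are `1`. -/
theorem adams_one_right {n : ℕ} (hn : 0 < n) : adams n (1 : R) = 1 := by
  refine (eq_adams (q := fun _ => (1 : R)) (fun m => ?_) hn).symm
  rw [NewtonAt]
  rcases m with _ | m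
  · simp [lam_zero, lam_one]
  · have h0 : ∀ i, lam (i + 1 + 1) (1 : R) = 0 := fun i => lam_apply_one _ (by omega)
    rw [Nat.sum_antidiagonal_eq_sum_range_succ (fun i j => lam i (1 : R) * ((-1) ^ j * 1)),
      sum_range_succ', sum_range_succ']
    simp [lam_zero, lam_one, h0, pow_succ]

theorem adams_mul (n : ℕ) (x y : R) : adams n (x * y) = adams n x * adams n y := by
  rcases n.eq_zero_or_pos with rfl | hn
  · simp [adams_zero_left]
  refine (eq_adams (q := fun i => adams i x * adams i y) (fun m => ?_) hn).symm
  let φ : MvPolynomial (ℕ ⊕ ℕ) ℤ →ₐ[ℤ] R :=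
    MvPolynomial.aeval (Sum.elim (fun i => lam (i + 1) x) (fun i => lam (i + 1) y))
  have h1 : (fun i => lam i (x * y)) = fun i => φ (univProd i) := by
    funext i
    rw [lam_mul, univProd, MvPolynomial.aeval_rename, Sum.elim_comp_map]
    rfl
  have h2 : (fun i => adams i x * adams i y) =
      fun i => φ (newtonSum (varSeq Sum.inl) i * newtonSum (varSeq Sum.inr) i) := by
    funext i
    rw [map_mul, adams_eq_newtonSum, adams_eq_newtonSum]
    have e1 : φ (newtonSum (varSeq Sum.inl) i) = newtonSum (fun i => lam i x) i := by
      refine (map_newtonSum φ.toRingHom _ i).trans (newtonSum_congr i fun j hj _ => ?_)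
      obtain ⟨j, rfl⟩ : ∃ m, j = m + 1 := ⟨j - 1, by omega⟩
      exact MvPolynomial.aeval_X _ _
    have e2 : φ (newtonSum (varSeq Sum.inr) i) = newtonSum (fun i => lam i y) i := by
      refine (map_newtonSum φ.toRingHom _ i).trans (newtonSum_congr i fun j hj _ => ?_)
      obtain ⟨j, rfl⟩ : ∃ m, j = m + 1 := ⟨j - 1, by omega⟩
      exact MvPolynomial.aeval_X _ _
    rw [e1, e2]
  rw [h1, h2]
  exact (newtonAt_univProd m).map φ.toRingHom

/-- The Adams operations are ring endomorphisms. -/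
noncomputable def adamsHom {n : ℕ} (hn : 0 < n) : R →+* R :=
  RingHom.mk' ⟨⟨adams n, adams_one_right hn⟩, adams_mul n⟩ (adams_add n)

theorem adamsHom_apply {n : ℕ} (hn : 0 < n) (x : R) : adamsHom hn x = adams n x := rfl

/-- The `λ`-operations on `x` as a specialisation of infinitely many variables. -/
noncomputable def lamEval (x : R) : MvPolynomial ℕ ℤ →ₐ[ℤ] R :=
  MvPolynomial.aeval fun i => lam (i + 1) x

theorem lamEval_newtonSum (x : R) (n : ℕ) :
    lamEval x (newtonSum (varSeq id) n) = adams n x := by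
  rw [adams_eq_newtonSum]
  refine (map_newtonSum (lamEval x).toRingHom _ n).trans (newtonSum_congr n fun j hj _ => ?_)
  obtain ⟨j, rfl⟩ : ∃ m, j = m + 1 := ⟨j - 1, by omega⟩
  exact MvPolynomial.aeval_X _ _

/-- By the power sums of `P_{m,n}`, the operation `ψᵐ` acts on `λⁿ(x)` as if it raised the roots of
`x` to the `m`-th power. -/
theorem adams_lam {m : ℕ} (hm : 0 < m) (n : ℕ) (x : R) :
    adams m (lam n x) = lamEval x (univPow m n) := by
  refine (eq_adams (q := fun i => lamEval x (univPow i n)) (fun k => ?_) hm).symm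
  have h1 : (fun i => lam i (lam n x)) = fun i => lamEval x (univComp i n) := by
    funext i
    rw [lam_lam, univComp, lamEval, MvPolynomial.aeval_rename]
    rfl
  rw [h1]
  exact (newtonAt_univComp n k).map (lamEval x).toRingHom

/-- As `ψᵐ` is a ring map, it sends the Newton sum of the `λⁱ(x)` to that of the `ψᵐ(λⁱ(x)) = eᵢ` of
the `m`-th powers of the roots. The `n`-th power sum of those is the one of degree `m * n` of the
roots. -/
theorem adams_adams (m n : ℕ) (x : R) : adams m (adams n x) = adams (m * n) x := by
  rcases m.eq_zero_or_pos with rfl | hm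
  · simp [adams_zero_left]
  rcases n with _ | n
  · rw [mul_zero, adams_zero_left, ← adamsHom_apply hm, map_zero]
  have h1 := map_newtonSum (adamsHom hm) (fun i => lam i x) (n + 1)
  have h2 : (fun i => adamsHom hm (lam i x)) = fun i => lamEval x (univPow m i) := by
    funext i
    rw [adamsHom_apply, adams_lam hm]
  rw [← adams_eq_newtonSum, adamsHom_apply, h2] at h1
  rw [h1, ← lamEval_newtonSum]
  exact (eq_newtonSum (by rw [univPow_zero_right, map_one]) n
    fun k _ => (newtonAt_univPow hm k).map (lamEval x).toRingHom).symm

end AdamsOperations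

/-! ### The `γ`-operations and the binomial expansion of `ψᵐ`. -/

section Gamma

variable {R : Type*} [CommRing R]

/-- The sequence `∑ⱼ (k - j choose n - j) cⱼ`. It turns the elementary symmetric functions of `k`
elements `uᵢ` into those of the elements `1 + uᵢ`. -/
def shiftSum (k : ℕ) (c : ℕ → R) (n : ℕ) : R :=
  ∑ j ∈ range (n + 1), ((k - j).choose (n - j) : R) * c j

theorem map_shiftSum {S : Type*} [CommRing S] (f : R →+* S) (k : ℕ) (c : ℕ → R) (n : ℕ) :
    f (shiftSum k c n) = shiftSum k (fun j => f (c j)) n := by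
  simp [shiftSum]

theorem shiftSum_succ_succ {k n : ℕ} (h : n < k) (c : ℕ → R) :
    shiftSum (k + 1) c (n + 1) = shiftSum k c (n + 1) + shiftSum k c n := by
  rw [shiftSum, sum_range_succ _ (n + 1), shiftSum, sum_range_succ _ (n + 1), shiftSum]
  have key : ∀ j ∈ range (n + 1), ((k + 1 - j).choose (n + 1 - j) : R) * c j =
      ((k - j).choose (n + 1 - j) : R) * c j + ((k - j).choose (n - j) : R) * c j := by
    intro j hj
    have hj' := mem_range.1 hj
    have e1 : k + 1 - j = k - j + 1 := by omega
    have e2 : n + 1 - j = n - j + 1 := by omega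
    rw [e1, e2, Nat.choose_succ_succ]
    push_cast
    ring
  rw [sum_congr rfl key, sum_add_distrib]
  simp only [Nat.sub_self, Nat.choose_zero_right]
  ring

/-- Substitute `X + 1` for `X` in `∏ (X + yᵢ)` and compare the coefficients of `X ^ (k - n)`. -/
theorem aeval_one_add_esymm {k : ℕ} (y : Fin k → R) {n : ℕ} (hn : n ≤ k) :
    MvPolynomial.aeval (fun j => 1 + y j) (MvPolynomial.esymm (Fin k) ℤ n) =
      shiftSum k (fun i => MvPolynomial.aeval y (MvPolynomial.esymm (Fin k) ℤ i)) n := by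
  have key : ∀ z : Fin k → R, ∏ i, (Polynomial.X + Polynomial.C (z i)) =
      ∑ j ∈ range (k + 1), Polynomial.C (MvPolynomial.aeval z (MvPolynomial.esymm (Fin k) ℤ j)) *
        Polynomial.X ^ (k - j) := by
    intro z
    have h := congrArg (Polynomial.map (MvPolynomial.aeval z : _ →ₐ[ℤ] R).toRingHom)
      (MvPolynomial.prod_C_add_X_eq_sum_esymm ℤ (Fin k))
    simpa [Polynomial.map_prod, Polynomial.map_sum] using h
  have h1 := congrArg (fun p => Polynomial.coeff (Polynomial.comp p (Polynomial.X + 1)) (k - n))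
    (key y)
  have h2 := congrArg (fun p => Polynomial.coeff p (k - n)) (key fun j => 1 + y j)
  have h3 : (∏ i, (Polynomial.X + Polynomial.C (y i))).comp (Polynomial.X + 1) =
      ∏ i, (Polynomial.X + Polynomial.C (1 + y i)) := by
    rw [Polynomial.prod_comp]
    refine prod_congr rfl fun i _ => ?_
    simp [add_assoc]
  simp only [h3] at h1
  replace h2 := h2.symm.trans h1
  rw [Polynomial.sum_comp, Polynomial.finsetSum_coeff, Polynomial.finsetSum_coeff,
    Finset.sum_eq_single n] at h2
  · simp only [Polynomial.coeff_C_mul, Polynomial.coeff_X_pow, if_true, mul_one,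
      Polynomial.mul_comp, Polynomial.C_comp, Polynomial.X_pow_comp,
      Polynomial.coeff_X_add_one_pow] at h2
    rw [h2, shiftSum]
    refine (sum_subset (range_subset_range.2 (show n + 1 ≤ k + 1 by omega)) fun j hj hj' => ?_).symm.trans ?_
    · rw [mem_range] at hj hj'
      rw [Nat.choose_eq_zero_of_lt (by omega)]
      simp
    · refine sum_congr rfl fun j hj => ?_
      rw [mem_range] at hj
      rw [mul_comm, ← Nat.choose_symm (show n - j ≤ k - j by omega)]
      congr 3
      omega
  · intro j hj hj'
    rw [mem_range] at hj
    rw [Polynomial.coeff_C_mul, Polynomial.coeff_X_pow, if_neg (by omega), mul_zero]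
  · intro h
    exact absurd (mem_range.2 (by omega)) h

variable [LambdaRing R]

theorem lam_add_one (n : ℕ) (x : R) : lam (n + 1) (x + 1) = lam (n + 1) x + lam n x := by
  rw [lam_add, sum_range_succ, sum_range_succ, sum_eq_zero]
  · simp [lam_zero, lam_one, add_comm]
  · intro i hi
    rw [mem_range] at hi
    rw [lam_apply_one _ (by omega), mul_zero]

theorem gamma_zero (x : R) : gamma 0 x = 1 := lam_zero _

theorem gamma_succ (n : ℕ) (x : R) : gamma (n + 1) x = lam (n + 1) (x + n) := by
  rw [gamma]
  push_cast
  ring_nf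

/-- This makes the heuristic of roots `1 + uᵢ` with `eⱼ(u) = γʲ(x)` precise: it is the same formula
as in `aeval_one_add_esymm`. The induction on `k` is Pascal's rule, except in the top degree `n = k
+ 1`, where the new term is `γ^(k+1)(x)` by definition. -/
theorem lam_add_natCast (x : R) {k n : ℕ} (h : n ≤ k) :
    lam n (x + k) = shiftSum k (fun j => gamma j x) n := by
  induction k generalizing n with
  | zero =>
    obtain rfl : n = 0 := by omega
    simp [shiftSum, lam_zero, gamma_zero]
  | succ k ih =>
    rcases n with _ | n
    · simp [shiftSum, lam_zero, gamma_zero]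
    rw [Nat.cast_succ, ← add_assoc, lam_add_one]
    rcases Nat.lt_or_ge n k with hn | hn
    · rw [ih hn, ih hn.le, shiftSum_succ_succ hn]
    · obtain rfl : n = k := by omega
      rw [← gamma_succ, ih le_rfl, shiftSum, shiftSum, sum_range_succ _ (n + 1)]
      simp [add_comm]

/-- The Adams operations in terms of the power sums attached to the `γ`-operations. -/
theorem adams_eq_sum_newtonSum_gamma (m : ℕ) (x : R) : adams m x =
    ∑ r ∈ range (m + 1), (m.choose r : R) * newtonSum (fun i => gamma i x) r := by
  rcases m.eq_zero_or_pos with rfl | hm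
  · simp [adams_zero_left, newtonSum_zero]
  -- This is `∑ⱼ (1 + uⱼ)ᵐ - m = ∑_{r ≥ 1} (m choose r) ∑ⱼ uⱼʳ` in `m` variables. The `m` must be
  -- subtracted because `newtonSum _ 0 = 0`, whereas the zeroth power sum of `m` roots is `m`.
  have hW : newtonSum (shiftSum m (varSeq id)) m - (m : MvPolynomial ℕ ℤ) -
      ∑ r ∈ range (m + 1), (m.choose r : MvPolynomial ℕ ℤ) * newtonSum (varSeq id) r = 0 := by
    refine eq_zero_of_toEsymm_eq_zero m _ (sub_mem (sub_mem ?_ (natCast_mem _ _))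
      (sum_mem fun r hr => mul_mem (natCast_mem _ _) ?_)) ?_
    · exact newtonSum_mem _ _ fun i _ hi => sum_mem fun j hj => mul_mem (natCast_mem _ _)
        (varSeq_mem_lowVars (by have := mem_range.1 hj; omega))
    · exact newtonSum_mem _ _ fun i _ hi =>
        varSeq_mem_lowVars (by have := mem_range.1 hr; omega)
    · have h1 : toEsymm m (newtonSum (shiftSum m (varSeq id)) m) =
          ∑ j, (1 + MvPolynomial.X j) ^ m := by
        rw [← newtonSum_aeval_esymm _ hm]
        refine (map_newtonSum (toEsymm m).toRingHom _ m).trans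
          (newtonSum_congr m fun i _ hi => ?_)
        rw [aeval_one_add_esymm _ hi, map_shiftSum]
        congr 1
        funext j
        refine (toEsymm_varSeq m j).trans ?_
        exact (MvPolynomial.aeval_X_left_apply _).symm
      have h2 : ∀ r, toEsymm m (newtonSum (varSeq id) (r + 1)) =
          ∑ j, MvPolynomial.X j ^ (r + 1) := fun r => toEsymm_newtonSum m r.succ_pos
      rw [map_sub, map_sub, h1, map_natCast, map_sum, sum_range_succ']
      simp only [map_mul, map_natCast, h2, newtonSum_zero, mul_zero]
      simp only [add_comm (1 : MvPolynomial (Fin m) ℤ), add_pow, one_pow, mul_one]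
      rw [sum_comm, sum_range_succ']
      simp [mul_sum, mul_comm]
  let φ : MvPolynomial ℕ ℤ →ₐ[ℤ] R := MvPolynomial.aeval fun i => gamma (i + 1) x
  have hφ : ∀ i, φ (varSeq id i) = gamma i x := by
    rintro (_ | i)
    · rw [varSeq, map_one, gamma_zero]
    · exact MvPolynomial.aeval_X _ _
  have h1 : φ (newtonSum (shiftSum m (varSeq id)) m) = adams m x + m := by
    have h3 : adams m (x + m) = adams m x + m := by
      rw [adams_add, ← adamsHom_apply hm (m : R), map_natCast]
    rw [← h3, adams_eq_newtonSum]
    refine (map_newtonSum φ.toRingHom _ m).trans (newtonSum_congr m fun i _ hi => ?_)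
    rw [lam_add_natCast x hi, map_shiftSum]
    exact congrArg (fun c => shiftSum m c i) (funext hφ)
  have h2 : ∀ r, φ (newtonSum (varSeq id) r) = newtonSum (fun i => gamma i x) r := fun r =>
    (map_newtonSum φ.toRingHom _ r).trans (newtonSum_congr r fun i _ _ => hφ i)
  have h := congrArg φ hW
  simp only [map_sub, map_sum, map_mul, map_natCast, map_zero, h1, h2] at h
  linear_combination h

/-! ### A polynomial annihilating the Adams operation. -/

/-- If all products of `γ`-operations of total degree at least `N` vanish on `x`, then so do the
power sums attached to the `γ`-operations, from degree `N` on. -/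
theorem newtonSum_gamma_eq_zero {N : ℕ} {x : R}
    (h : ∀ L : List ℕ, N ≤ L.sum → (L.map fun n => gamma n x).prod = 0) {r : ℕ} (hr : N ≤ r) :
    newtonSum (fun i => gamma i x) r = 0 := by
  -- Newton's recursion lowers `r` while splitting off a factor `γ^(i+1)(x)`. Carrying an arbitrary
  -- product of `γ`'s along keeps the total weight at least `N`.
  suffices key : ∀ L : List ℕ, N ≤ L.sum + r →
      (L.map fun n => gamma n x).prod * newtonSum (fun i => gamma i x) r = 0 by
    simpa using key [] (by simpa using hr)
  clear hr
  induction r using Nat.strong_induction_on with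
  | _ r ih =>
    intro L hL
    rcases r with _ | r
    · rw [newtonSum_zero, mul_zero]
    rw [newtonSum_succ, mul_add, mul_sum]
    have h1 := h ((r + 1) :: L) (by rw [List.sum_cons]; omega)
    rw [List.map_cons, List.prod_cons] at h1
    rw [sum_eq_zero fun i hi => ?_, zero_add]
    · linear_combination ((-1) ^ r * ((r + 1 : ℕ) : R)) * h1
    · have hi' := mem_range.1 hi
      have h2 := ih (r - i) (by omega) ((i + 1) :: L) (by rw [List.sum_cons]; omega)
      rw [List.map_cons, List.prod_cons] at h2
      linear_combination ((-1) ^ i) * h2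

/-- Expanding `r! * (bʲ choose r)` as the falling factorial `∑ₙ cₙ (bⁿ)ʲ` turns `r!` times the sum
into `∑ₙ cₙ P(bⁿ)`. The division by `r!` takes place in `ℤ`, so torsion in the `λ`-ring does no
harm. -/
theorem sum_coeff_mul_choose_pow_eq_zero {P : Polynomial ℤ} {b r : ℕ} (hr : 0 < r)
    (hP : ∀ n, 0 < n → n ≤ r → P.eval ((b : ℤ) ^ n) = 0) :
    ∑ j ∈ range (P.natDegree + 1), P.coeff j * ((b ^ j).choose r : ℤ) = 0 := by
  have hf : (r.factorial : ℤ) ≠ 0 := by exact_mod_cast r.factorial_ne_zero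
  refine (mul_eq_zero.1 ?_).resolve_left hf
  have h1 : ∀ j, (r.factorial : ℤ) * ((b ^ j).choose r : ℤ) =
      ∑ n ∈ range (r + 1), (descPochhammer ℤ r).coeff n * ((b : ℤ) ^ n) ^ j := by
    intro j
    have h2 := descPochhammer_eval_eq_descFactorial ℤ (b ^ j) r
    rw [Polynomial.eval_eq_sum_range, descPochhammer_natDegree,
      Nat.descFactorial_eq_factorial_mul_choose] at h2
    push_cast at h2
    rw [← h2]
    exact sum_congr rfl fun n _ => by rw [← pow_mul, ← pow_mul, mul_comm j]
  calc (r.factorial : ℤ) * ∑ j ∈ range (P.natDegree + 1), P.coeff j * ((b ^ j).choose r : ℤ)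
      = ∑ j ∈ range (P.natDegree + 1), ∑ n ∈ range (r + 1),
          (descPochhammer ℤ r).coeff n * (P.coeff j * ((b : ℤ) ^ n) ^ j) := by
        rw [mul_sum]
        refine sum_congr rfl fun j _ => ?_
        rw [mul_left_comm, h1, mul_sum]
        exact sum_congr rfl fun n _ => by ring
    _ = ∑ n ∈ range (r + 1), (descPochhammer ℤ r).coeff n * P.eval ((b : ℤ) ^ n) := by
        rw [sum_comm]
        exact sum_congr rfl fun n _ => by rw [← mul_sum, Polynomial.eval_eq_sum_range]
    _ = 0 := by
        refine sum_eq_zero fun n hn => ?_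
        have hn' := mem_range.1 hn
        -- For `r > 0` the falling factorial has no constant term, which is why `P` need not vanish
        -- at `b⁰ = 1`.
        rcases n.eq_zero_or_pos with rfl | hn0
        · rw [Polynomial.coeff_zero_eq_eval_zero, descPochhammer_ne_zero_eval_zero _ hr.ne',
            zero_mul]
        · rw [hP n hn0 (by omega), mul_zero]

/-- A polynomial in the Adams operation `ψᵇ` that vanishes at `b, b², …, b^(N-1)` annihilates the
elements on which products of `γ`-operations of total degree at least `N` vanish. -/
theorem sum_coeff_mul_adams_pow_eq_zero {N : ℕ} {x : R}
    (h : ∀ L : List ℕ, N ≤ L.sum → (L.map fun n => gamma n x).prod = 0) {P : Polynomial ℤ} {b : ℕ}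
    (hP : ∀ n, 0 < n → n < N → P.eval ((b : ℤ) ^ n) = 0) :
    ∑ j ∈ range (P.natDegree + 1), (P.coeff j : R) * adams (b ^ j) x = 0 := by
  -- The range of summation becomes independent of `m`: terms with `r > m` have zero binomial
  -- coefficient, and terms with `r ≥ N` vanish by finiteness of the filtration.
  have h1 : ∀ m, adams m x =
      ∑ r ∈ range N, (m.choose r : R) * newtonSum (fun i => gamma i x) r := by
    intro m
    rw [adams_eq_sum_newtonSum_gamma]
    rcases le_total (m + 1) N with hm | hm
    · refine sum_subset (range_subset_range.2 hm) fun r _ hr => ?_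
      rw [mem_range, not_lt] at hr
      rw [Nat.choose_eq_zero_of_lt (by omega), Nat.cast_zero, zero_mul]
    · refine (sum_subset (range_subset_range.2 hm) fun r _ hr => ?_).symm
      rw [mem_range, not_lt] at hr
      rw [newtonSum_gamma_eq_zero h hr, mul_zero]
  simp only [h1, mul_sum]
  rw [sum_comm]
  refine sum_eq_zero fun r hr => ?_
  simp only [← mul_assoc]
  rw [← sum_mul]
  rcases r.eq_zero_or_pos with rfl | hr0
  · rw [newtonSum_zero, mul_zero]
  have h2 := sum_coeff_mul_choose_pow_eq_zero hr0
    fun n hn hn' => hP n hn (hn'.trans_lt (mem_range.1 hr))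
  have h3 := congrArg (Int.cast : ℤ → R) h2
  push_cast at h3
  rw [h3, zero_mul]

theorem HasFiniteGammaFiltration.exists_list {S : Type*} [CommRing S] {ε : R →+* S}
    (h : HasFiniteGammaFiltration ε) : ∃ N : ℕ, ∀ x ∈ RingHom.ker ε, ∀ L : List ℕ, N ≤ L.sum →
      (L.map fun n => gamma n x).prod = 0 := by
  obtain ⟨N, hN⟩ := h
  refine ⟨N, fun x hx L hL => ?_⟩
  rw [← Fin.prod_univ_fun_getElem]
  refine hN L.length (fun _ => x) (fun i => L[i]) (fun _ => hx) ?_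
  have h := Fin.sum_univ_fun_getElem L id
  rw [List.map_id] at h
  exact hL.trans h.ge

theorem map_adams_coe {H : Subring R} {ε : R →+* H} (hε : IsLambdaSection H ε) (n : ℕ) (x : R) :
    (ε (adams n x) : R) = adams n (ε x : R) := by
  rw [adams_eq_newtonSum, adams_eq_newtonSum]
  refine (map_newtonSum (H.subtype.comp ε) _ n).trans (newtonSum_congr n fun i _ _ => ?_)
  exact hε.map_lam i x

theorem adams_mem_ker {H : Subring R} {ε : R →+* H} (hε : IsLambdaSection H ε) {n : ℕ} (hn : 0 < n)
    {x : R} (hx : x ∈ RingHom.ker ε) : adams n x ∈ RingHom.ker ε := by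
  rw [RingHom.mem_ker] at hx ⊢
  apply Subtype.ext
  rw [map_adams_coe hε, hx, ZeroMemClass.coe_zero, ← adamsHom_apply hn, map_zero]

/-- The Adams operation `ψⁿ` on the kernel of `ε`. -/
def adamsKer {H : Subring R} {ε : R →+* H} (hε : IsLambdaSection H ε) {n : ℕ} (hn : 0 < n) :
    AddMonoid.End (RingHom.ker ε) :=
  AddMonoidHom.mk' (fun a => ⟨adams n a, adams_mem_ker hε hn a.2⟩)
    fun a b => Subtype.ext (adams_add n (a : R) (b : R))

theorem coe_adamsKer {H : Subring R} {ε : R →+* H} (hε : IsLambdaSection H ε) {n : ℕ}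
    (hn : 0 < n) (a : RingHom.ker ε) : (adamsKer hε hn a : R) = adams n (a : R) := rfl

theorem coe_adamsKer_pow {H : Subring R} {ε : R →+* H} (hε : IsLambdaSection H ε) {n : ℕ}
    (hn : 0 < n) (j : ℕ) (a : RingHom.ker ε) :
    ((adamsKer hε hn ^ j) a : R) = adams (n ^ j) (a : R) := by
  induction j with
  | zero => rw [pow_zero, pow_zero, adams_one_left]; rfl
  | succ j ih =>
    rw [pow_succ', pow_succ', ← adams_adams, ← ih]
    rfl

/-- If the `γ`-filtration is finite, then `∏ (ψⁿ - nⁱ)`, for `i` from `1` to some bound, vanishes on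
the kernel of `ε`. -/
theorem exists_aeval_adamsKer_eq_zero {H : Subring R} {ε : R →+* H} (hε : IsLambdaSection H ε)
    (hfin : HasFiniteGammaFiltration ε) {n : ℕ} (hn : 0 < n) : ∃ N : ℕ,
      Polynomial.aeval (adamsKer hε hn)
        (∏ i ∈ range N, (Polynomial.X - Polynomial.C ((n : ℤ) ^ (i + 1)))) = 0 := by
  obtain ⟨N, hN⟩ := hfin.exists_list
  refine ⟨N, ?_⟩
  set P : Polynomial ℤ := ∏ i ∈ range N, (Polynomial.X - Polynomial.C ((n : ℤ) ^ (i + 1))) with hP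
  ext a
  have h1 : ((Polynomial.aeval (adamsKer hε hn) P a : RingHom.ker ε) : R) =
      ∑ j ∈ range (P.natDegree + 1), (P.coeff j : R) * adams (n ^ j) (a : R) := by
    rw [Polynomial.aeval_eq_sum_range]
    refine (congrArg Subtype.val (AddMonoidHom.finsetSum_apply _ _ a)).trans ?_
    rw [AddSubmonoidClass.coe_finsetSum]
    refine sum_congr rfl fun j _ => ?_
    rw [← coe_adamsKer_pow hε hn, ← zsmul_eq_mul]
    rfl
  rw [h1, sum_coeff_mul_adams_pow_eq_zero (hN a a.2)]
  · rfl
  · intro i hi hiN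
    rw [hP, Polynomial.eval_prod]
    refine prod_eq_zero (mem_range.2 (show i - 1 < N by omega)) ?_
    rw [Nat.sub_add_cancel hi]
    simp

end Gamma

end LambdaRing

/-! ### Colimits of an endomorphism as localisations. -/

namespace EndColimit

variable {A : Type*} [AddCommGroup A] (θ : AddMonoid.End A)

theorem step_apply {i j : ℕ} (h : i ≤ j) (x : A) : step θ i j h x = (θ ^ (j - i)) x := rfl

instance directedSystem_step :
    DirectedSystem (fun _ : ℕ => A) fun i j h => step θ i j h where
  map_self i x := by rw [step_apply, Nat.sub_self, pow_zero]; rfl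
  map_map k j i _ _ x := by
    rw [step_apply, step_apply, step_apply]
    change (θ ^ (k - j) * θ ^ (j - i)) x = _
    rw [← pow_add]
    congr 2
    omega

/-- The canonical map from the `i`-th term to the colimit. -/
noncomputable def ι (i : ℕ) : A →+ EndColimit θ :=
  AddCommGroup.DirectLimit.of (fun _ : ℕ => A) (step θ) i

theorem ι_add (i j : ℕ) (x : A) : ι θ (i + j) ((θ ^ j) x) = ι θ i x := by
  have h := AddCommGroup.DirectLimit.of_f (G := fun _ : ℕ => A) (f := step θ)
    (Nat.le_add_right i j) x
  rwa [step_apply, Nat.add_sub_cancel_left] at h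

theorem exists_ι (y : EndColimit θ) : ∃ i x, ι θ i x = y := by
  induction y using AddCommGroup.DirectLimit.induction_on with
  | ih i x => exact ⟨i, x, rfl⟩

theorem exists_pow_apply_eq_zero {i : ℕ} {x : A} (h : ι θ i x = 0) : ∃ j, (θ ^ j) x = 0 := by
  obtain ⟨j, hij, hj⟩ := AddCommGroup.DirectLimit.of.zero_exact (G := fun _ : ℕ => A)
    (f := fun i j h => step θ i j h) i x h
  exact ⟨j - i, hj⟩

/-- If some power of `θ` is divisible by `ℓ` and some power of `ℓ` is divisible by `θ`, the
divisions commuting with `θ`, then the colimit of `θ` is the localisation at `ℓ`. -/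
theorem isLocalizedModule_of {ℓ : ℤ} {a b : ℕ} {q r : AddMonoid.End A}
    (hq : θ ^ a = ℓ • q) (hqθ : Commute q θ) (hr : (ℓ ^ b : ℤ) • (1 : AddMonoid.End A) = θ * r)
    (hrθ : Commute r θ) :
    IsLocalizedModule (Submonoid.powers ℓ) (of θ).toIntLinearMap := by
  have hr' : ∀ (i : ℕ) (x : A), (ℓ ^ (b * i) : ℤ) • x = (θ ^ i) ((r ^ i) x) := by
    intro i x
    have h : (ℓ ^ (b * i) : ℤ) • (1 : AddMonoid.End A) = θ ^ i * r ^ i := by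
      rw [← hrθ.symm.mul_pow, ← hr, smul_pow, one_pow, pow_mul]
    exact DFunLike.congr_fun h x
  have hinj : ∀ y : EndColimit θ, ℓ • y = 0 → y = 0 := by
    intro y hy
    obtain ⟨i, x, rfl⟩ := exists_ι θ y
    rw [← map_zsmul] at hy
    obtain ⟨j, hj⟩ := exists_pow_apply_eq_zero θ hy
    have h : (θ ^ (j + a)) x = 0 := by
      rw [pow_add, hq, mul_smul_comm, ← (hqθ.pow_right j).eq]
      change ℓ • q ((θ ^ j) x) = 0
      rw [← map_zsmul, ← map_zsmul, hj, map_zero]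
    rw [← ι_add θ i (j + a), h, map_zero]
  have hsurj : ∀ y : EndColimit θ, ∃ z, ℓ • z = y := by
    intro y
    obtain ⟨i, x, rfl⟩ := exists_ι θ y
    -- Moving `x` forward `a` places turns it into `θᵃ x = ℓ • q x`.
    refine ⟨ι θ (i + a) (q x), ?_⟩
    rw [← ι_add θ i a, hq, ← map_zsmul]
    rfl
  have hunit : IsUnit (algebraMap ℤ (Module.End ℤ (EndColimit θ)) ℓ) := by
    rw [Module.End.isUnit_iff]
    refine ⟨(injective_iff_map_eq_zero _).2 hinj, hsurj⟩
  constructor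
  · rintro ⟨_, n, rfl⟩
    change IsUnit (algebraMap ℤ (Module.End ℤ (EndColimit θ)) (ℓ ^ n))
    rw [map_pow]
    exact hunit.pow n
  · intro y
    obtain ⟨i, x, rfl⟩ := exists_ι θ y
    -- Here `ℓ ^ (b * i)` is `θⁱ rⁱ`, and `θⁱ` brings an element of the first term to the `i`-th
    -- place.
    refine ⟨((r ^ i) x, ⟨ℓ ^ (b * i), b * i, rfl⟩), ?_⟩
    change (ℓ ^ (b * i) : ℤ) • ι θ i x = ι θ 0 ((r ^ i) x)
    rw [← map_zsmul, hr', ← ι_add θ 0 i, zero_add]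
  · intro x y hxy
    have h : ι θ 0 (x - y) = 0 := by rw [map_sub]; exact sub_eq_zero.2 hxy
    obtain ⟨j, hj⟩ := exists_pow_apply_eq_zero θ h
    refine ⟨⟨ℓ ^ (b * j), b * j, rfl⟩, ?_⟩
    change (ℓ ^ (b * j) : ℤ) • x = (ℓ ^ (b * j) : ℤ) • y
    rw [← sub_eq_zero, ← smul_sub, hr']
    change (θ ^ j * r ^ j) (x - y) = 0
    rw [← (hrθ.pow_pow j j).eq]
    change (r ^ j) ((θ ^ j) (x - y)) = 0
    rw [hj, map_zero]

/-- If `∏ (θ - ℓⁱ)`, `i` from `1` to some bound, vanishes, then the colimit of `θ` is the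
localisation at `ℓ`. -/
theorem isLocalizedModule_of_aeval_prod_eq_zero {ℓ : ℤ} {N : ℕ}
    (h : Polynomial.aeval θ (∏ i ∈ range N, (Polynomial.X - Polynomial.C (ℓ ^ (i + 1)))) = 0) :
    IsLocalizedModule (Submonoid.powers ℓ) (of θ).toIntLinearMap := by
  -- Every exponent `i + 1` is positive, so each factor of the product is congruent to `X` modulo
  -- `ℓ`.
  obtain ⟨Q, hQ⟩ : ∃ Q : Polynomial ℤ, (Polynomial.X : Polynomial ℤ) ^ N =
      Polynomial.C ℓ * Q + ∏ i ∈ range N, (Polynomial.X - Polynomial.C (ℓ ^ (i + 1))) := by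
    clear h
    induction N with
    | zero => exact ⟨0, by simp⟩
    | succ N ih =>
      obtain ⟨Q, hQ⟩ := ih
      refine ⟨Q * Polynomial.X + Polynomial.C (ℓ ^ N) *
        ∏ i ∈ range N, (Polynomial.X - Polynomial.C (ℓ ^ (i + 1))), ?_⟩
      rw [prod_range_succ, pow_succ, hQ, pow_succ, Polynomial.C_mul]
      ring
  -- The constant term of the product is `(-1)ᴺ ℓ^(1 + 2 + ⋯ + N)`; the induction builds `b` as this
  -- sum.
  obtain ⟨b, T, hT⟩ : ∃ (b : ℕ) (T : Polynomial ℤ), Polynomial.C (ℓ ^ b) =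
      Polynomial.X * T +
        (-1) ^ N * ∏ i ∈ range N, (Polynomial.X - Polynomial.C (ℓ ^ (i + 1))) := by
    clear h hQ
    induction N with
    | zero => exact ⟨0, 0, by simp⟩
    | succ N ih =>
      obtain ⟨b, T, hT⟩ := ih
      refine ⟨b + (N + 1), T * Polynomial.C (ℓ ^ (N + 1)) + (-1) ^ N *
        ∏ i ∈ range N, (Polynomial.X - Polynomial.C (ℓ ^ (i + 1))), ?_⟩
      rw [prod_range_succ, pow_add, Polynomial.C_mul, hT]
      ring
  have hQ' := congrArg (Polynomial.aeval θ) hQ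
  have hT' := congrArg (Polynomial.aeval θ) hT
  rw [map_add, h, add_zero, map_mul, map_pow, Polynomial.aeval_X, Polynomial.aeval_C,
    ← Algebra.smul_def] at hQ'
  rw [map_add, map_mul, map_mul, h, mul_zero, add_zero, Polynomial.aeval_X, Polynomial.aeval_C,
    Algebra.algebraMap_eq_smul_one] at hT'
  have hc : ∀ P : Polynomial ℤ, Commute (Polynomial.aeval θ P) θ := fun P => by
    simpa using (Commute.all P Polynomial.X).map (Polynomial.aeval θ)
  exact isLocalizedModule_of θ hQ' (hc Q) hT' (hc T)

end EndColimit

theorem IsLocalizedModule.exists_addEquiv_localizedModule {R M M' : Type*} [CommRing R]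
    [AddCommGroup M] [AddCommGroup M'] [Module R M] [Module R M'] (S : Submonoid R)
    (f : M →ₗ[R] M') [IsLocalizedModule S f] :
    ∃ e : M' ≃+ LocalizedModule S M, ∀ a, e (f a) = LocalizedModule.mkLinearMap S M a :=
  ⟨(IsLocalizedModule.iso S f).symm.toAddEquiv, IsLocalizedModule.iso_symm_apply S f⟩

theorem mainTheorem4 {Λ : Type*} [CommRing Λ] [LambdaRing Λ]
    (H₀ : Subring Λ) (hH₀ : LambdaRing.IsBinomialLambdaSubring H₀)
    (ε : Λ →+* H₀) (hε : LambdaRing.IsLambdaSection H₀ ε)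
    (hfin : LambdaRing.HasFiniteGammaFiltration ε)
    (ℓ : ℕ) (hℓ : 0 < ℓ) :
    ∃ θ : AddMonoid.End (RingHom.ker ε),
      (∀ a : RingHom.ker ε, (θ a : Λ) = LambdaRing.adams ℓ (a : Λ)) ∧
      ∃ e : EndColimit θ ≃+ InvertInt (ℓ : ℤ) (RingHom.ker ε),
        ∀ a : RingHom.ker ε,
          e (EndColimit.of θ a) = InvertInt.of (ℓ : ℤ) (RingHom.ker ε) a := by
  obtain ⟨N, hN⟩ := LambdaRing.exists_aeval_adamsKer_eq_zero hε hfin hℓ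
  have hloc := EndColimit.isLocalizedModule_of_aeval_prod_eq_zero _ hN
  obtain ⟨e, he⟩ := IsLocalizedModule.exists_addEquiv_localizedModule (Submonoid.powers (ℓ : ℤ))
    (EndColimit.of (LambdaRing.adamsKer hε hℓ)).toIntLinearMap
  exact ⟨LambdaRing.adamsKer hε hℓ, LambdaRing.coe_adamsKer hε hℓ, e, he⟩
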